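/- Consider quantum circuits on $m$ qubits built from arbitrary $1$-qubit unitary gates and C-SIGN gates of arbitrary arity, where the C-SIGN gate on a set $S$ of qubits maps a computational basis state $|x\rangle$ to $-|x\rangle$ if $x_i=1$ for all $i\in S$, and fixes it otherwise (QAC circuits). Such a circuit has depth $2$ if it consists of two layers, each made of C-SIGN gates acting on pairwise disjoint sets of qubits (a layer may leave qubits untouched), where arbitrary $1$-qubit gates may be applied before, between and after the two layers. For an $n$-qubit unitary $G$, a circuit $C$ on $m\ge n$ qubits cleanly simulates $G$ if $C(|x\rangle\otimes|0^{m-n}\rangle)=(G|x\rangle)\otimes|0^{m-n}\rangle$ for all $x\in\{0,1\}^n$; the last $m-n$ qubits are the ancilla qubits. Let $\oplus_n$ be the parity gate, $\oplus_n|x_1,x_2,\dots,x_n\rangle=|x_1\oplus\cdots\oplus x_n,x_2,\dots,x_n\rangle$, and $F_n$ the fanout gate, $F_n|x_1,x_2,\dots,x_n\rangle=|x_1,x_1\oplus x_2,\dots,x_1\oplus x_n\rangle$. Theorem. For every $n\ge 4$ and every number of ancilla qubits, no depth-$2$ QAC circuit cleanly simulates $\oplus_n$, and no depth-$2$ QAC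 circuit cleanly simulates $F_n$. The bound for parity is tight: there is a depth-$2$ QAC circuit on $3$ qubits (without ancilla qubits) that cleanly simulates $\oplus_3$. -/

import Mathlib

namespace QAC

/-- Bit strings of length `m`. They label the computational basis of the space of `m` qubits;
the first qubit has index `0`. Addition of bits is addition modulo `2`. -/
abbrev Bits (m : ℕ) : Type := Fin m → Fin 2

/-- Vectors of the space of `m` qubits, in coordinates for the computational basis. -/
abbrev State (m : ℕ) : Type := Bits m → ℂ

/-- Linear operators on the space of `m` qubits, as matrices in the computational basis. -/
abbrev Op (m : ℕ) : Type := Matrix (Bits m) (Bits m) ℂ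

/-- The computational basis vector `|x⟩`. -/
def ket {m : ℕ} (x : Bits m) : State m := Pi.single x 1

/-- The tensor product of a state of the first `n` qubits and a state of the last `a` qubits. -/
def tensor {n a : ℕ} (ψ : State n) (φ : State a) : State (n + a) :=
  fun z => ψ (fun i => z (Fin.castAdd a i)) * φ (fun j => z (Fin.natAdd n j))

/-- One single-qubit unitary gate for every qubit (possibly the identity). -/
abbrev SingleLayer (m : ℕ) : Type := Fin m → Matrix.unitaryGroup (Fin 2) ℂ

/-- The operator of a layer of single-qubit gates: the tensor product of the gates. -/
def SingleLayer.op {m : ℕ} (U : SingleLayer m) : Op m :=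
  Matrix.of fun x y => ∏ i, (U i : Matrix (Fin 2) (Fin 2) ℂ) (x i) (y i)

/-- The C-SIGN gate acting on the set `S` of qubits of an `m`-qubit register (with the identity
on the other qubits): `|x⟩` is multiplied by `-1` if all bits of `x` in `S` are `1`, and is fixed
otherwise. In particular the gate on the empty set is `-I`. -/
def csign {m : ℕ} (S : Finset (Fin m)) : Op m :=
  Matrix.diagonal fun x => if ∀ i ∈ S, x i = 1 then -1 else 1

/-- A layer of C-SIGN gates of arbitrary arities, acting on pairwise disjoint sets of qubits.
The layer may leave some or all of the qubits untouched. -/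
structure CSignLayer (m : ℕ) where
  /-- the sets of qubits on which the gates act -/
  gates : List (Finset (Fin m))
  disjoint : gates.Pairwise Disjoint

/-- The operator of a layer of C-SIGN gates: the product of its (commuting) gates. -/
def CSignLayer.op {m : ℕ} (L : CSignLayer m) : Op m := (L.gates.map csign).prod

/-- `Circuit m d`: QAC circuits on `m` qubits with `d` layers of C-SIGN gates, preceded, separated
and followed by arbitrary single-qubit gates, which do not count towards the depth `d`.
As layers of C-SIGN gates may be empty, circuits of smaller depth are included. -/
inductive Circuit (m : ℕ) : ℕ → Type
  /-- a circuit without C-SIGN gates -/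
  | single (U : SingleLayer m) : Circuit m 0
  /-- apply the circuit `C`, then the C-SIGN layer `L`, then the single-qubit gates `U` -/
  | step {d : ℕ} (C : Circuit m d) (L : CSignLayer m) (U : SingleLayer m) : Circuit m (d + 1)

/-- The operator computed by a circuit. -/
def Circuit.op {m : ℕ} : {d : ℕ} → Circuit m d → Op m
  | _, .single U => U.op
  | _, .step C L U => U.op * L.op * C.op

/-- A circuit on `n + a` qubits, with input qubits the first `n` and ancilla qubits the last `a`,
cleanly simulates the `n`-qubit operator `G` if
`C (|x⟩ ⊗ |0^a⟩) = (G |x⟩) ⊗ |0^a⟩` for all bit strings `x` of length `n`. -/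
def Circuit.CleanlySimulates {n a d : ℕ} (C : Circuit (n + a) d) (G : Op n) : Prop :=
  ∀ x : Bits n, C.op.mulVec (tensor (ket x) (ket 0)) = tensor (G.mulVec (ket x)) (ket 0)

/-- The operator that maps `|x⟩` to `|f x⟩` for every bit string `x`. -/
def classicalGate {n : ℕ} (f : Bits n → Bits n) : Op n :=
  Matrix.of fun y x => if y = f x then 1 else 0

/-- The `n`-qubit parity gate: `|x₁, x₂, …, xₙ⟩ ↦ |x₁ ⊕ ⋯ ⊕ xₙ, x₂, …, xₙ⟩`. -/
def parityGate (n : ℕ) : Op n :=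
  classicalGate fun x i => if (i : ℕ) = 0 then ∑ j, x j else x i

/-- The `n`-qubit fanout gate: `|x₁, x₂, …, xₙ⟩ ↦ |x₁, x₁ ⊕ x₂, …, x₁ ⊕ xₙ⟩`. -/
def fanoutGate (n : ℕ) : Op n :=
  classicalGate fun x i => if (i : ℕ) = 0 then x i else x ⟨0, i.pos⟩ + x i

end QAC

/-! For parity, undo the second C-SIGN layer and the last single-qubit gates: for every `x`, the
first layer applied to a product state equals the second layer applied to a product state labelled
by the parity image of `x`. Pair both sides, bilinearly, with a product vector `ξ`. A C-SIGN gate is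
the identity minus twice a rank-one projection, so each side factors over its gates into differences
of two products (`prodVec_dotProduct_layer`), polynomial in `ξ`.

Fix the target qubit `o` and contract all the others. On `o` the gate containing it then acts, up to
a scalar, as `1 - 2tP` with `P` a rank-one projection, and the weight `t` is a product of one ratio
per remaining qubit (`F_update`). Flipping an input bit exchanges the two values of the target on
one side only. If the other side still leaves `o` in the same state up to scalars, the two weights
add up to `1` (`weight_add_weight`). Using this with two bits `k`, `l` forces the ratio at `k` not
to depend on its bit and the weight to be `1/2` (`ratio_eq_and_weight_eq`); for generic `ξ` such
equalities fail.

Hence each layer's gate at `o` contains at least two of any three other input qubits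
(`ParityRelated.mem_or_mem`), while a qubit in both gates excludes the other two from the second
(`ParityRelated.not_mem`). Two 2-subsets of a 3-set intersect, a contradiction. Fanout is parity
conjugated by Hadamard gates, which the single-qubit layers absorb. -/

namespace QAC

open Function

/-! ### Polynomial functions of a family of vectors -/

section Generic

variable {ι : Type*}

/-- Functions of a family of vectors in `ℂ²` that are given by a nonzero polynomial. -/
def IsNonzeroPoly (f : (ι → Fin 2 → ℂ) → ℂ) : Prop :=
  ∃ P : MvPolynomial (ι × Fin 2) ℂ, P ≠ 0 ∧ ∀ ξ, f ξ = MvPolynomial.eval (fun q => ξ q.1 q.2) P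

/-- Functions of a family of vectors in `ℂ²` that are given by a polynomial. -/
def IsPoly (f : (ι → Fin 2 → ℂ) → ℂ) : Prop :=
  ∃ P : MvPolynomial (ι × Fin 2) ℂ, ∀ ξ, f ξ = MvPolynomial.eval (fun q => ξ q.1 q.2) P

theorem IsPoly.const (a : ℂ) : IsPoly fun _ : ι → Fin 2 → ℂ => a :=
  ⟨MvPolynomial.C a, fun ξ => by simp⟩

theorem IsPoly.coord (i : ι) (k : Fin 2) : IsPoly fun ξ : ι → Fin 2 → ℂ => ξ i k :=
  ⟨MvPolynomial.X (i, k), fun ξ => by simp⟩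

theorem IsPoly.add {f g : (ι → Fin 2 → ℂ) → ℂ} (hf : IsPoly f) (hg : IsPoly g) :
    IsPoly fun ξ => f ξ + g ξ := by
  obtain ⟨P, hP⟩ := hf
  obtain ⟨Q, hQ⟩ := hg
  exact ⟨P + Q, fun ξ => by simp [hP, hQ]⟩

theorem IsPoly.mul {f g : (ι → Fin 2 → ℂ) → ℂ} (hf : IsPoly f) (hg : IsPoly g) :
    IsPoly fun ξ => f ξ * g ξ := by
  obtain ⟨P, hP⟩ := hf
  obtain ⟨Q, hQ⟩ := hg
  exact ⟨P * Q, fun ξ => by simp [hP, hQ]⟩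

theorem IsPoly.sub {f g : (ι → Fin 2 → ℂ) → ℂ} (hf : IsPoly f) (hg : IsPoly g) :
    IsPoly fun ξ => f ξ - g ξ := by
  obtain ⟨P, hP⟩ := hf
  obtain ⟨Q, hQ⟩ := hg
  exact ⟨P - Q, fun ξ => by simp [hP, hQ]⟩

theorem IsPoly.prod {κ : Type*} {f : κ → (ι → Fin 2 → ℂ) → ℂ} (hf : ∀ a, IsPoly (f a))
    (s : Finset κ) : IsPoly fun ξ => ∏ a ∈ s, f a ξ := by
  choose P hP using hf
  exact ⟨∏ a ∈ s, P a, fun ξ => by simp [hP]⟩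

theorem IsPoly.isNonzeroPoly {f : (ι → Fin 2 → ℂ) → ℂ} (hf : IsPoly f) {ξ : ι → Fin 2 → ℂ}
    (h : f ξ ≠ 0) : IsNonzeroPoly f := by
  obtain ⟨P, hP⟩ := hf
  refine ⟨P, ?_, hP⟩
  rintro rfl
  exact h (by simp [hP])

theorem IsNonzeroPoly.one : IsNonzeroPoly fun _ : ι → Fin 2 → ℂ => 1 :=
  ⟨1, one_ne_zero, fun ξ => by simp⟩

theorem IsNonzeroPoly.mul {f g : (ι → Fin 2 → ℂ) → ℂ} (hf : IsNonzeroPoly f)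
    (hg : IsNonzeroPoly g) : IsNonzeroPoly fun ξ => f ξ * g ξ := by
  obtain ⟨P, hP0, hP⟩ := hf
  obtain ⟨Q, hQ0, hQ⟩ := hg
  exact ⟨P * Q, mul_ne_zero hP0 hQ0, fun ξ => by simp [hP, hQ]⟩

theorem IsNonzeroPoly.prod {κ : Type*} {f : κ → (ι → Fin 2 → ℂ) → ℂ}
    (hf : ∀ a, IsNonzeroPoly (f a)) (s : Finset κ) : IsNonzeroPoly fun ξ => ∏ a ∈ s, f a ξ := by
  choose P hP0 hP using hf
  exact ⟨∏ a ∈ s, P a, Finset.prod_ne_zero_iff.2 fun a _ => hP0 a, fun ξ => by simp [hP]⟩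

theorem IsNonzeroPoly.list_prod {κ : Type*} {f : κ → (ι → Fin 2 → ℂ) → ℂ}
    (hf : ∀ a, IsNonzeroPoly (f a)) (l : List κ) :
    IsNonzeroPoly fun ξ => (l.map fun a => f a ξ).prod := by
  induction l with
  | nil => simpa using IsNonzeroPoly.one
  | cons a l ih => simpa using (hf a).mul ih

theorem IsNonzeroPoly.exists_ne_zero {f : (ι → Fin 2 → ℂ) → ℂ} (hf : IsNonzeroPoly f) :
    ∃ ξ, f ξ ≠ 0 := by
  obtain ⟨P, hP0, hP⟩ := hf
  by_contra! h
  refine hP0 (MvPolynomial.funext fun v => ?_)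
  have := h fun i k => v (i, k)
  rw [hP] at this
  simpa using this

end Generic

/-! ### Contraction of a single gate -/

/-- For every qubit a basis of `ℂ²`, the columns of `A i`, and the coefficients `c i` of a
unit vector. -/
structure Frame (ι : Type*) where
  /-- the bases -/
  A : ι → Matrix (Fin 2) (Fin 2) ℂ
  /-- the coefficients -/
  c : ι → Fin 2 → ℂ
  isUnit_det : ∀ i, IsUnit (A i).det
  norm : ∀ i, c i 0 * star (c i 0) + c i 1 * star (c i 1) = 1

namespace Frame

variable {ι : Type*} (D : Frame ι)

/-- The pairing of `v` with a basis vector. -/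
def lin (i : ι) (b : Fin 2) (v : Fin 2 → ℂ) : ℂ := Matrix.vecMul v (D.A i) b

/-- The pairing of `v` with the unit vector. -/
def proj (i : ι) (v : Fin 2 → ℂ) : ℂ := star (D.c i 0) * D.lin i 0 v + star (D.c i 1) * D.lin i 1 v

theorem exists_lin_eq (i : ι) (w : Fin 2 → ℂ) : ∃ v, ∀ b, D.lin i b v = w b := by
  refine ⟨Matrix.vecMul w (D.A i)⁻¹, fun b => ?_⟩
  rw [lin, Matrix.vecMul_vecMul, Matrix.nonsing_inv_mul _ (D.isUnit_det i), Matrix.vecMul_one]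

theorem exists_lin_ne_zero {i : ι} {v : Fin 2 → ℂ} (hv : v ≠ 0) : ∃ b, D.lin i b v ≠ 0 := by
  by_contra! h
  refine hv ?_
  have h0 : Matrix.vecMul v (D.A i) = 0 := funext h
  have := congrArg (fun w => Matrix.vecMul w (D.A i)⁻¹) h0
  simpa [Matrix.vecMul_vecMul, Matrix.mul_nonsing_inv _ (D.isUnit_det i)] using this

theorem exists_proj_eq_zero (i : ι) : ∃ v, v ≠ 0 ∧ D.proj i v = 0 := by
  obtain ⟨v, hv⟩ := D.exists_lin_eq i ![star (D.c i 1), -star (D.c i 0)]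
  have h0 : D.lin i 0 v = star (D.c i 1) := by simpa using hv 0
  have h1 : D.lin i 1 v = -star (D.c i 0) := by simpa using hv 1
  refine ⟨v, ?_, by rw [proj, h0, h1]; ring⟩
  rintro rfl
  have e1 : star (D.c i 1) = 0 := by rw [← h0]; simp [lin]
  have e0 : star (D.c i 0) = 0 := by rw [← neg_eq_zero, ← h1]; simp [lin]
  simpa [e0, e1] using D.norm i

theorem isPoly_lin (i : ι) (b : Fin 2) : IsPoly fun ξ => D.lin i b (ξ i) := by
  simp only [lin, Matrix.vecMul, dotProduct, Fin.sum_univ_two]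
  exact ((IsPoly.coord i 0).mul (.const _)).add ((IsPoly.coord i 1).mul (.const _))

theorem isPoly_proj (i : ι) : IsPoly fun ξ => D.proj i (ξ i) :=
  ((IsPoly.const _).mul (D.isPoly_lin i 0)).add ((IsPoly.const _).mul (D.isPoly_lin i 1))

theorem isNonzeroPoly_lin (i : ι) (b : Fin 2) : IsNonzeroPoly fun ξ => D.lin i b (ξ i) := by
  obtain ⟨v, hv⟩ := D.exists_lin_eq i 1
  refine (D.isPoly_lin i b).isNonzeroPoly (ξ := fun _ => v) ?_
  simp [hv]

/-- The contraction of a reflected product state with the family `ξ`. -/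
def block (ε : ℂ) (S : Finset ι) (x : ι → Fin 2) (ξ : ι → Fin 2 → ℂ) : ℂ :=
  ∏ i ∈ S, D.lin i (x i) (ξ i) - 2 * ε * ∏ i ∈ S, D.c i (x i) * D.proj i (ξ i)

/-- If the gate is present and no `c i (x i)` vanishes, pairing with the vectors whose coordinates
are `c i` makes every `proj` equal to `1`, leaving `P - 2P = -P` with `P` the product of the `c i (x
i)`. Otherwise the subtracted term vanishes identically, and coordinates all `1` suffice. -/
theorem isNonzeroPoly_block {ε : ℂ} (hε : ε = 0 ∨ ε = 1) (S : Finset ι) (x : ι → Fin 2) :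
    IsNonzeroPoly (D.block ε S x) := by
  have hpoly : IsPoly (D.block ε S x) :=
    (IsPoly.prod (fun i => D.isPoly_lin i (x i)) S).sub
      ((IsPoly.const _).mul (IsPoly.prod (fun i => (IsPoly.const _).mul (D.isPoly_proj i)) S))
  by_cases h : ε = 1 ∧ ∀ i ∈ S, D.c i (x i) ≠ 0
  · choose v hv using fun i => D.exists_lin_eq i (D.c i)
    refine hpoly.isNonzeroPoly (ξ := v) ?_
    have hp : ∀ i, D.proj i (v i) = 1 := fun i => by
      rw [proj, hv, hv, ← D.norm i]; ring
    have : D.block ε S x v = -∏ i ∈ S, D.c i (x i) := by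
      simp only [block, hv, hp, h.1]
      ring_nf
    rw [this]
    exact neg_ne_zero.2 (Finset.prod_ne_zero_iff.2 h.2)
  · choose v hv using fun i => D.exists_lin_eq i 1
    refine hpoly.isNonzeroPoly (ξ := v) ?_
    have h0 : ε * ∏ i ∈ S, D.c i (x i) * D.proj i (v i) = 0 := by
      rcases hε with rfl | rfl
      · simp
      · push Not at h
        obtain ⟨i, hi, hc⟩ := h rfl
        rw [Finset.prod_eq_zero hi (by simp [hc]), mul_zero]
    simp [block, hv, mul_assoc, h0]

end Frame

/-! ### The state of one qubit after contraction of the others -/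

/-- The contraction, as a function of a family of vectors, of a layer of C-SIGN gates applied to
product states, with the gate containing the qubit `o` split off. -/
structure Side (ι : Type*) [Fintype ι] [DecidableEq ι] (o : ι) extends Frame ι where
  /-- the set of qubits of the gate containing `o` -/
  S : Finset ι
  mem_S : o ∈ S
  /-- `0` if there is no gate containing `o` -/
  ε : ℂ
  ε_eq : ε = 0 ∨ ε = 1
  /-- the contraction of the state of the other qubits -/
  rest : (ι → Fin 2) → (ι → Fin 2 → ℂ) → ℂ
  isNonzeroPoly_rest : ∀ x, IsNonzeroPoly (rest x)
  rest_congr : ∀ x x' ξ ξ', (∀ i, i ∉ S → x i = x' i ∧ ξ i = ξ' i) → rest x ξ = rest x' ξ'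

namespace Side

variable {ι : Type*} [Fintype ι] [DecidableEq ι] {o : ι} (Y : Side ι o)

/-- The contraction of the whole state. -/
def F (x : ι → Fin 2) (ξ : ι → Fin 2 → ℂ) : ℂ := Y.block Y.ε Y.S x ξ * Y.rest x ξ

/-- The contribution of the qubit `i` to the weight of the reflection. -/
noncomputable def ratio (i : ι) (b : Fin 2) (v : Fin 2 → ℂ) : ℂ :=
  if i ∈ Y.S then Y.c i b * Y.proj i v / Y.lin i b v else 1

/-- The weight of the reflection on the qubit `o` after contraction of the other qubits. -/
noncomputable def weight (x : ι → Fin 2) (ξ : ι → Fin 2 → ℂ) : ℂ :=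
  Y.ε * ∏ i ∈ Finset.univ.erase o, Y.ratio i (x i) (ξ i)

/-- The scalar by which the state of `o` is multiplied before its reflection. -/
def scale (x : ι → Fin 2) (ξ : ι → Fin 2 → ℂ) : ℂ := ∏ i ∈ Y.S.erase o, Y.lin i (x i) (ξ i)

theorem prod_ratio (x : ι → Fin 2) (ξ : ι → Fin 2 → ℂ) :
    ∏ i ∈ Finset.univ.erase o, Y.ratio i (x i) (ξ i) =
      ∏ i ∈ Y.S.erase o, Y.c i (x i) * Y.proj i (ξ i) / Y.lin i (x i) (ξ i) := by
  symm
  refine Finset.prod_subset_one_on_sdiff (Finset.erase_subset_erase _ (Finset.subset_univ _))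
    (fun i hi => ?_) fun i hi => ?_
  · have : i ∉ Y.S := fun h => by simp_all
    simp [ratio, this]
  · simp [ratio, (Finset.mem_erase.1 hi).2]

theorem block_update (x : ι → Fin 2) (ξ : ι → Fin 2 → ℂ) (b : Fin 2) (η : Fin 2 → ℂ) (ε : ℂ) :
    Y.block ε Y.S (update x o b) (update ξ o η) =
      Y.lin o b η * Y.scale x ξ -
        2 * ε * (Y.c o b * Y.proj o η * ∏ i ∈ Y.S.erase o, Y.c i (x i) * Y.proj i (ξ i)) := by
  rw [Frame.block, ← Finset.mul_prod_erase _ _ Y.mem_S, ← Finset.mul_prod_erase _ _ Y.mem_S]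
  simp only [update_self, scale]
  congr 2
  · refine Finset.prod_congr rfl fun i hi => ?_
    rw [update_of_ne (Finset.ne_of_mem_erase hi), update_of_ne (Finset.ne_of_mem_erase hi)]
  · congr 1
    refine Finset.prod_congr rfl fun i hi => ?_
    rw [update_of_ne (Finset.ne_of_mem_erase hi), update_of_ne (Finset.ne_of_mem_erase hi)]

theorem rest_update (x : ι → Fin 2) (ξ : ι → Fin 2 → ℂ) (i : ι) (hi : i ∈ Y.S) (b : Fin 2)
    (η : Fin 2 → ℂ) : Y.rest (update x i b) (update ξ i η) = Y.rest x ξ :=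
  Y.rest_congr _ _ _ _ fun k hk => by
    have : k ≠ i := fun h => hk (h ▸ hi)
    simp [this]

theorem scale_mul_prod_ratio {x : ι → Fin 2} {ξ : ι → Fin 2 → ℂ} (h : Y.scale x ξ ≠ 0) :
    Y.scale x ξ * ∏ i ∈ Finset.univ.erase o, Y.ratio i (x i) (ξ i) =
      ∏ i ∈ Y.S.erase o, Y.c i (x i) * Y.proj i (ξ i) := by
  rw [prod_ratio, Finset.prod_div_distrib, ← scale, mul_div_cancel₀ _ h]

theorem F_update {x : ι → Fin 2} {ξ : ι → Fin 2 → ℂ} (h : Y.scale x ξ ≠ 0) (b : Fin 2)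
    (η : Fin 2 → ℂ) :
    Y.F (update x o b) (update ξ o η) =
      (Y.lin o b η - 2 * Y.weight x ξ * (Y.c o b * Y.proj o η)) * (Y.scale x ξ * Y.rest x ξ) := by
  rw [F, block_update, rest_update _ _ _ _ Y.mem_S, ← Y.scale_mul_prod_ratio h, weight]
  ring

/-- If the states of `o` for opposite values of its bit and two contractions of the other qubits
agree up to scalars, then the weights add up to `1`. -/
theorem weight_add_weight {x x' : ι → Fin 2} {ξ : ι → Fin 2 → ℂ} (h : Y.scale x ξ ≠ 0)
    (h' : Y.scale x' ξ ≠ 0) (hr : Y.rest x ξ ≠ 0) (hr' : Y.rest x' ξ ≠ 0)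
    (Λ : Fin 2 → (Fin 2 → ℂ) → ℂ) (g g' : Fin 2 → ℂ)
    (hΛ : ∀ b η, Y.F (update x o b) (update ξ o η) = Λ b η * g b)
    (hΛ' : ∀ b η, Y.F (update x' o (b + 1)) (update ξ o η) = Λ b η * g' b) :
    Y.weight x ξ + Y.weight x' ξ = 1 := by
  -- Testing with the dual basis at `o` reads off the coordinates of `(1 - 2tP)` applied to a basis
  -- vector.
  obtain ⟨v, hv⟩ := Y.exists_lin_eq o ![1, 0]
  obtain ⟨w, hw⟩ := Y.exists_lin_eq o ![0, 1]
  have hv0 : Y.lin o 0 v = 1 := by simpa using hv 0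
  have hv1 : Y.lin o 1 v = 0 := by simpa using hv 1
  have hw0 : Y.lin o 0 w = 0 := by simpa using hw 0
  have hw1 : Y.lin o 1 w = 1 := by simpa using hw 1
  have pv : Y.proj o v = star (Y.c o 0) := by rw [Frame.proj, hv0, hv1]; ring
  have pw : Y.proj o w = star (Y.c o 1) := by rw [Frame.proj, hw0, hw1]; ring
  simp only [Y.F_update h] at hΛ
  simp only [Y.F_update h'] at hΛ'
  have e01 : (0 : Fin 2) + 1 = 1 := rfl
  have e11 : (1 : Fin 2) + 1 = 0 := rfl
  have a0v := hΛ 0 v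
  have a0w := hΛ 0 w
  have a1v := hΛ 1 v
  have a1w := hΛ 1 w
  have b0v := hΛ' 0 v
  have b0w := hΛ' 0 w
  have b1v := hΛ' 1 v
  have b1w := hΛ' 1 w
  rw [e01] at b0v b0w
  rw [e11] at b1v b1w
  simp only [hv0, hv1, hw0, hw1, pv, pw] at a0v a0w a1v a1w b0v b0w b1v b1w
  have hN : Y.c o 0 * star (Y.c o 0) + Y.c o 1 * star (Y.c o 1) = 1 := Y.norm o
  have hk : Y.scale x ξ * Y.rest x ξ * (Y.scale x' ξ * Y.rest x' ξ) ≠ 0 :=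
    mul_ne_zero (mul_ne_zero h hr) (mul_ne_zero h' hr')
  generalize Y.scale x ξ * Y.rest x ξ = p at *
  generalize Y.scale x' ξ * Y.rest x' ξ = p' at *
  generalize Y.weight x ξ = t at *
  generalize Y.weight x' ξ = t' at *
  generalize star (Y.c o 0) = d0 at *
  generalize star (Y.c o 1) = d1 at *
  generalize Y.c o 0 = c0 at *
  generalize Y.c o 1 = c1 at *
  -- Two vectors proportional to `Λ 0` have vanishing determinant. The terms in `t * t'` cancel
  -- because the projection has rank one. Adding the analogous relation for `Λ 1` and using the norm
  -- of `c` gives `t + t' = 1`.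
  have k0 : p * p' * (1 - 2 * t * (c0 * d0) - 2 * t' * (c1 * d1)) = 0 := by
    linear_combination ((1 - 2 * t' * (c1 * d1)) * p') * a0v + (Λ 0 v * g 0) * b0w
      - ((0 - 2 * t' * (c1 * d0)) * p') * a0w - (Λ 0 w * g 0) * b0v
  have k1 : p * p' * (1 - 2 * t * (c1 * d1) - 2 * t' * (c0 * d0)) = 0 := by
    linear_combination ((1 - 2 * t' * (c0 * d0)) * p') * a1w + (Λ 1 w * g 1) * b1v
      - ((0 - 2 * t' * (c0 * d1)) * p') * a1v - (Λ 1 v * g 1) * b1w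
  have m0 := (mul_eq_zero.1 k0).resolve_left hk
  have m1 := (mul_eq_zero.1 k1).resolve_left hk
  linear_combination (-1 / 2 : ℂ) * m0 - (1 / 2 : ℂ) * m1 - (t + t') * hN

theorem weight_update (x : ι → Fin 2) (ξ : ι → Fin 2 → ℂ) {k : ι} (hk : k ≠ o) (b : Fin 2) :
    Y.weight (update x k b) ξ =
      Y.ratio k b (ξ k) * (Y.ε * ∏ i ∈ (Finset.univ.erase o).erase k, Y.ratio i (x i) (ξ i)) := by
  have hk' : k ∈ Finset.univ.erase o := by simp [hk]
  rw [weight, ← Finset.mul_prod_erase _ _ hk', update_self]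
  rw [Finset.prod_congr rfl fun i hi => by rw [update_of_ne (Finset.ne_of_mem_erase hi)]]
  ring

theorem weight_update_update (x : ι → Fin 2) (ξ : ι → Fin 2 → ℂ) {k l : ι} (hk : k ≠ o)
    (hl : l ≠ o) (hkl : k ≠ l) :
    ∃ τ, ∀ α β, Y.weight (update (update x k α) l β) ξ =
      τ * Y.ratio k α (ξ k) * Y.ratio l β (ξ l) := by
  have hk' : k ∈ (Finset.univ.erase o).erase l := by simp [hk, hkl]
  refine ⟨Y.ε * ∏ i ∈ ((Finset.univ.erase o).erase l).erase k, Y.ratio i (x i) (ξ i),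
    fun α β => ?_⟩
  rw [weight_update _ _ _ hl, ← Finset.mul_prod_erase _ _ hk', update_self]
  rw [Finset.prod_congr rfl fun i hi => by rw [update_of_ne (Finset.ne_of_mem_erase hi)]]
  ring

/-- The four weights have the form `τ * a α * b β`, and weights whose bits differ in one place add
up to `1`. Thus `τ * a 0 * (b 0 + b 1)` and `τ * a 1 * (b 0 + b 1)` are both `1`, so `a 0 = a 1`;
flipping the bit at `k` then does not change the weight, which is therefore `1 / 2`. -/
theorem ratio_eq_and_weight_eq {x : ι → Fin 2} {ξ : ι → Fin 2 → ℂ} {k l : ι} (hk : k ≠ o)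
    (hl : l ≠ o) (hkl : k ≠ l) (h : ∀ α β, Y.scale (update (update x k α) l β) ξ ≠ 0)
    (hr : ∀ α β, Y.rest (update (update x k α) l β) ξ ≠ 0)
    (Λ : Fin 2 → (Fin 2 → ℂ) → ℂ) (g : Fin 2 → Fin 2 → Fin 2 → ℂ)
    (hΛ : ∀ α β b η, Y.F (update (update (update x k α) l β) o (b + (α + β))) (update ξ o η) =
      Λ b η * g α β b) :
    Y.ratio k 0 (ξ k) = Y.ratio k 1 (ξ k) ∧
      Y.weight (update (update x k 0) l 0) ξ = 1 / 2 := by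
  have e0 : ∀ b : Fin 2, b + (0 + 0) = b := by decide
  have e1 : ∀ b : Fin 2, b + (1 + 1) = b := by decide
  have e2 : ∀ b : Fin 2, b + (0 + 1) = b + 1 := by decide
  have e3 : ∀ b : Fin 2, b + (1 + 0) = b + 1 := by decide
  have h00 := hΛ 0 0
  have h01 := hΛ 0 1
  have h10 := hΛ 1 0
  have h11 := hΛ 1 1
  simp only [e0] at h00
  simp only [e1] at h11
  simp only [e2] at h01
  simp only [e3] at h10
  have s1 := Y.weight_add_weight (h 0 0) (h 0 1) (hr 0 0) (hr 0 1) Λ _ _ h00 h01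
  have s2 := Y.weight_add_weight (h 0 0) (h 1 0) (hr 0 0) (hr 1 0) Λ _ _ h00 h10
  have s3 := Y.weight_add_weight (h 1 1) (h 1 0) (hr 1 1) (hr 1 0) Λ _ _ h11 h10
  obtain ⟨τ, hτ⟩ := Y.weight_update_update x ξ hk hl hkl
  simp only [hτ] at s1 s2 s3 ⊢
  generalize Y.ratio k 0 (ξ k) = a0 at *
  generalize Y.ratio k 1 (ξ k) = a1 at *
  generalize Y.ratio l 0 (ξ l) = b0 at *
  generalize Y.ratio l 1 (ξ l) = b1 at *
  have n : τ * (b0 + b1) ≠ 0 := fun h0 => one_ne_zero (α := ℂ) (by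
    linear_combination a0 * h0 - s1)
  have ha : a0 = a1 := mul_left_cancel₀ n (by linear_combination s1 - s3)
  subst ha
  exact ⟨rfl, by linear_combination (1 / 2 : ℂ) * s2⟩

/-! ### Which qubits share a gate with the target -/

/-- Two layers of C-SIGN gates are related by the parity of the bits `o`, `j`, `k`, `l`, added
to the bit `o`. -/
def ParityRelated (X Y : Side ι o) (j k l : ι) : Prop :=
  ∀ x ξ, (∀ i, i ≠ o → i ≠ j → i ≠ k → i ≠ l → x i = 0) →
    X.F x ξ = Y.F (update x o (x o + x j + x k + x l)) ξ

/-- The bit string with bits `ζ`, `α`, `β` at `j`, `k`, `l`. -/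
def bitsAt (j k l : ι) (ζ α β : Fin 2) : ι → Fin 2 := update (update (update 0 j ζ) k α) l β

variable {j k l : ι} {X Y}

theorem ParityRelated.symm (h : ParityRelated X Y j k l) (hj : j ≠ o) (hk : k ≠ o) (hl : l ≠ o) :
    ParityRelated Y X j k l := by
  intro x ξ hx
  rw [h _ _ fun i h0 h1 h2 h3 => by rw [update_of_ne h0, hx i h0 h1 h2 h3]]
  simp only [update_self, update_of_ne hj, update_of_ne hk, update_of_ne hl, update_idem]
  have : ∀ p q r s : Fin 2, p + q + r + s + q + r + s = p := by decide
  rw [this, update_eq_self]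

theorem ParityRelated.perm (h : ParityRelated X Y j k l) : ParityRelated X Y k l j := by
  intro x ξ hx
  rw [h x ξ fun i h0 h1 h2 h3 => hx i h0 h2 h3 h1]
  have : ∀ p q r s : Fin 2, p + q + r + s = p + r + s + q := by decide
  rw [this]

theorem ParityRelated.swap (h : ParityRelated X Y j k l) : ParityRelated X Y j l k := by
  intro x ξ hx
  rw [h x ξ fun i h0 h1 h2 h3 => hx i h0 h1 h3 h2]
  have : ∀ p q r s : Fin 2, p + q + r + s = p + q + s + r := by decide
  rw [this]

theorem ParityRelated.F_eq (h : ParityRelated X Y j k l) (hj : j ≠ o) (hk : k ≠ o) (hl : l ≠ o)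
    (hjk : j ≠ k) (hjl : j ≠ l) (hkl : k ≠ l) (ζ α β b : Fin 2) (ξ : ι → Fin 2 → ℂ) :
    Y.F (update (bitsAt j k l ζ α β) o (b + (α + β))) ξ =
      X.F (update (bitsAt j k l ζ α β) o (b + ζ)) ξ := by
  rw [h _ _ fun i h0 h1 h2 h3 => by simp [bitsAt, h0, h1, h2, h3]]
  simp only [update_self, update_of_ne hj, update_of_ne hk, update_of_ne hl, update_idem]
  have : b + ζ + bitsAt j k l ζ α β j + bitsAt j k l ζ α β k + bitsAt j k l ζ α β l =
      b + (α + β) := by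
    simp only [bitsAt, update_self, update_of_ne hkl, update_of_ne hjk, update_of_ne hjl]
    revert b ζ α β
    decide
  rw [this]

/-- A family of vectors at which finitely many nonzero polynomials do not vanish. -/
theorem exists_generic {f : (ι → Fin 2 → ℂ) → ℂ} (hf : IsNonzeroPoly f) :
    ∃ ξ, f ξ ≠ 0 ∧ (∀ i b, Y.lin i b (ξ i) ≠ 0) ∧ ∀ x, Y.rest x ξ ≠ 0 := by
  obtain ⟨ξ, hξ⟩ := (hf.mul ((IsNonzeroPoly.prod
    (fun q : ι × Fin 2 => Y.isNonzeroPoly_lin q.1 q.2) Finset.univ).mul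
      (IsNonzeroPoly.prod Y.isNonzeroPoly_rest Finset.univ))).exists_ne_zero
  have h1 := left_ne_zero_of_mul (right_ne_zero_of_mul hξ)
  have h2 := right_ne_zero_of_mul (right_ne_zero_of_mul hξ)
  rw [Finset.prod_ne_zero_iff] at h1 h2
  exact ⟨ξ, left_ne_zero_of_mul hξ, fun i b => h1 (i, b) (Finset.mem_univ _),
    fun x => h2 x (Finset.mem_univ _)⟩

/-- If `X`'s gate at `o` missed both `k` and `l`, their bits would affect `X`'s state of `o` only by
a scalar, and `Y`'s weight would be `1 / 2` for generic `ξ`. This makes `Y`'s block on `Y.S.erase o`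
vanish, although it is a nonzero polynomial. -/
theorem ParityRelated.mem_or_mem (h : ParityRelated X Y j k l) (hj : j ≠ o) (hk : k ≠ o)
    (hl : l ≠ o) (hjk : j ≠ k) (hjl : j ≠ l) (hkl : k ≠ l) : k ∈ X.S ∨ l ∈ X.S := by
  by_contra! hS
  obtain ⟨hkS, hlS⟩ := hS
  obtain ⟨ξ, hf, hlin, hrest⟩ := exists_generic (Y := Y)
    (Y.isNonzeroPoly_block Y.ε_eq (Y.S.erase o) (bitsAt j k l 0 0 0))
  have hscale : ∀ x, Y.scale x ξ ≠ 0 := fun x => Finset.prod_ne_zero_iff.2 fun i _ => hlin i _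
  have key := (Y.ratio_eq_and_weight_eq (x := update 0 j 0) (ξ := ξ) hk hl hkl
    (fun _ _ => hscale _) (fun _ _ => hrest _)
    (fun b η => X.block X.ε X.S (update (bitsAt j k l 0 0 0) o (b + 0)) (update ξ o η))
    (fun α β b => X.rest (bitsAt j k l 0 α β) ξ) fun α β b η => by
      have := h.F_eq hj hk hl hjk hjl hkl 0 α β b (update ξ o η)
      rw [bitsAt] at this
      rw [this, F, X.rest_update _ _ _ X.mem_S]
      congr 1
      have hx : ∀ i ∈ X.S, update (update (update (update (0 : ι → Fin 2) j 0) k α) l β) o (b + 0) i =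
          update (bitsAt j k l 0 0 0) o (b + 0) i := fun i hi => by
        have h1 : i ≠ k := fun e => hkS (e ▸ hi)
        have h2 : i ≠ l := fun e => hlS (e ▸ hi)
        by_cases h0 : i = o
        · simp [h0]
        · simp [bitsAt, h0, h1, h2]
      rw [Frame.block, Frame.block]
      congr 1
      · exact Finset.prod_congr rfl fun i hi => by rw [hx i hi]
      · congr 1
        exact Finset.prod_congr rfl fun i hi => by rw [hx i hi]).2
  refine hf ?_
  rw [Frame.block, ← scale, ← Y.scale_mul_prod_ratio (hscale _)]
  rw [weight] at key
  have key' : Y.ε * ∏ i ∈ Finset.univ.erase o, Y.ratio i (bitsAt j k l 0 0 0 i) (ξ i) = 1 / 2 := key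
  linear_combination (-2 * Y.scale (bitsAt j k l 0 0 0) ξ) * key'

/-- A suitable vector at `j` kills the projection term of `X`'s gate, so that `X`'s state of `o` no
longer depends on the bits of `k` and `l` except by a scalar. Then `Y`'s ratio at `k` is the same
for both bits, which fails generically when `k` lies in `Y`'s gate. -/
theorem ParityRelated.not_mem (h : ParityRelated X Y j k l) (hj : j ≠ o) (hk : k ≠ o)
    (hl : l ≠ o) (hjk : j ≠ k) (hjl : j ≠ l) (hkl : k ≠ l) (hjX : j ∈ X.S) (hjY : j ∈ Y.S) :
    k ∉ Y.S := by
  intro hkY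
  have hdiff : IsNonzeroPoly fun ξ : ι → Fin 2 → ℂ =>
      (Y.c k 0 * Y.lin k 1 (ξ k) - Y.c k 1 * Y.lin k 0 (ξ k)) * Y.proj k (ξ k) := by
    have hpoly := ((IsPoly.const (Y.c k 0)).mul (Y.isPoly_lin k 1)).sub
      ((IsPoly.const (Y.c k 1)).mul (Y.isPoly_lin k 0))
    obtain ⟨v, hv⟩ := Y.exists_lin_eq k ![-star (Y.c k 1), star (Y.c k 0)]
    obtain ⟨w, hw⟩ := Y.exists_lin_eq k (Y.c k)
    have h0 : Y.lin k 0 v = -star (Y.c k 1) := by simpa using hv 0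
    have h1 : Y.lin k 1 v = star (Y.c k 0) := by simpa using hv 1
    refine (hpoly.isNonzeroPoly (ξ := fun _ => v) ?_).mul
      ((Y.isPoly_proj k).isNonzeroPoly (ξ := fun _ => w) ?_)
    · have : Y.c k 0 * Y.lin k 1 v - Y.c k 1 * Y.lin k 0 v = 1 := by
        rw [h0, h1, ← Y.norm k]; ring
      rw [this]
      exact one_ne_zero
    · have : Y.proj k w = 1 := by
        rw [Frame.proj, hw, hw, ← Y.norm k]; ring
      rw [this]
      exact one_ne_zero
  obtain ⟨ξ, hf, hlin, hrest⟩ := exists_generic (Y := Y) hdiff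
  obtain ⟨v, hv0, hv⟩ := X.exists_proj_eq_zero j
  -- The vector `v` is not generic, so the bit at `j` is chosen to keep `Y.scale` nonzero. `Y.rest`
  -- does not see `j`, because `j ∈ Y.S`.
  obtain ⟨ζ, hζ⟩ := Y.exists_lin_ne_zero (i := j) hv0
  have hbit : ∀ α β, bitsAt j k l ζ α β j = ζ := fun α β => by simp [bitsAt, hjk, hjl]
  have key := (Y.ratio_eq_and_weight_eq (x := update 0 j ζ) (ξ := update ξ j v) hk hl hkl
    (fun α β => Finset.prod_ne_zero_iff.2 fun i _ => by
      by_cases hij : i = j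
      · subst hij
        have := hbit α β
        rw [bitsAt] at this
        rwa [this, update_self]
      · rw [update_of_ne hij]
        exact hlin _ _)
    (fun α β => by
      have := Y.rest_update (update (update (update 0 j ζ) k α) l β) ξ j hjY ζ v
      rw [show update (update (update (update (0 : ι → Fin 2) j ζ) k α) l β) j ζ =
        update (update (update (0 : ι → Fin 2) j ζ) k α) l β by
          rw [update_eq_iff]; exact ⟨(hbit α β).symm, fun _ _ => rfl⟩] at this
      rw [this]
      exact hrest _)
    (fun b η => X.lin o (b + ζ) η)
    (fun α β b => X.scale (bitsAt j k l ζ α β) (update ξ j v) *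
      X.rest (bitsAt j k l ζ α β) (update ξ j v)) fun α β b η => by
      have := h.F_eq hj hk hl hjk hjl hkl ζ α β b (update (update ξ j v) o η)
      rw [bitsAt] at this
      rw [this, F, X.rest_update _ _ _ X.mem_S, X.block_update,
        Finset.prod_eq_zero (Finset.mem_erase.2 ⟨hj, hjX⟩) (by rw [update_self, hv, mul_zero])]
      rw [← bitsAt]
      ring).1
  rw [update_of_ne hjk.symm, ratio, ratio, if_pos hkY, if_pos hkY,
    div_eq_div_iff (hlin _ _) (hlin _ _)] at key
  exact hf (by linear_combination key)

/-- Two layers of C-SIGN gates do not compute the parity of four bits. -/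
theorem not_parityRelated (hj : j ≠ o) (hk : k ≠ o) (hl : l ≠ o) (hjk : j ≠ k) (hjl : j ≠ l)
    (hkl : k ≠ l) : ¬ ParityRelated X Y j k l := by
  intro h
  -- `x1`–`x3` and `y1`–`y3` put at least two of `j`, `k`, `l` into each gate; `z1`–`z3` and
  -- `w1`–`w3` cover all ordered pairs of them.
  have hs := h.symm hj hk hl
  have x1 := h.mem_or_mem hj hk hl hjk hjl hkl
  have x2 := h.perm.mem_or_mem hk hl hj hkl hjk.symm hjl.symm
  have x3 := h.perm.perm.mem_or_mem hl hj hk hjl.symm hkl.symm hjk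
  have y1 := hs.mem_or_mem hj hk hl hjk hjl hkl
  have y2 := hs.perm.mem_or_mem hk hl hj hkl hjk.symm hjl.symm
  have y3 := hs.perm.perm.mem_or_mem hl hj hk hjl.symm hkl.symm hjk
  have z1 := h.not_mem hj hk hl hjk hjl hkl
  have z2 := h.perm.not_mem hk hl hj hkl hjk.symm hjl.symm
  have z3 := h.perm.perm.not_mem hl hj hk hjl.symm hkl.symm hjk
  have w1 := h.swap.not_mem hj hl hk hjl hjk hkl.symm
  have w2 := h.perm.swap.not_mem hk hj hl hjk.symm hkl hjl
  have w3 := h.perm.perm.swap.not_mem hl hk hj hkl.symm hjl.symm hjk.symm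
  clear h hs
  grind

end Side

/-! ### Contraction of a layer with product vectors -/

section Layer

variable {m : ℕ}

theorem sum_prod_eq_prod_sum (f : Fin m → Fin 2 → ℂ) :
    ∑ z : Bits m, ∏ i, f i (z i) = ∏ i, (f i 0 + f i 1) := by
  have := Finset.prod_univ_sum (fun _ : Fin m => (Finset.univ : Finset (Fin 2))) f
  rw [Fintype.piFinset_univ] at this
  rw [← this]
  simp only [Fin.sum_univ_two]

/-- A layer of C-SIGN gates maps a sum of product weights to a product over its gates. -/
theorem sum_csign_mul_prod (gs : List (Finset (Fin m))) (hgs : gs.Pairwise Disjoint)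
    (f : Fin m → Fin 2 → ℂ) :
    ∑ z : Bits m, (gs.map fun S => if ∀ i ∈ S, z i = 1 then (-1 : ℂ) else 1).prod *
        ∏ i, f i (z i) =
      (gs.map fun S => ∏ i ∈ S, (f i 0 + f i 1) - 2 * ∏ i ∈ S, f i 1).prod *
        ∏ i with ∀ S ∈ gs, i ∉ S, (f i 0 + f i 1) := by
  induction gs generalizing f with
  | nil => simpa using sum_prod_eq_prod_sum f
  | cons S gs ih =>
    rw [List.pairwise_cons] at hgs
    obtain ⟨hS, hgs⟩ := hgs
    -- The gate on `S` subtracts twice the weight supported on strings with all bits in `S` equal to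
    -- `1`; that restricted weight is again a product.
    let f' : Fin m → Fin 2 → ℂ := fun i b => if i ∈ S ∧ b = 0 then 0 else f i b
    have hsplit : ∀ z : Bits m, (if ∀ i ∈ S, z i = 1 then (-1 : ℂ) else 1) * ∏ i, f i (z i) =
        ∏ i, f i (z i) - 2 * ∏ i, f' i (z i) := fun z => by
      by_cases h : ∀ i ∈ S, z i = 1
      · have : ∀ i, f' i (z i) = f i (z i) := fun i => if_neg fun ⟨hi, h0⟩ => by
          rw [h i hi] at h0; exact one_ne_zero h0
        simp only [if_pos h, this]
        ring
      · rw [if_neg h]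
        push Not at h
        obtain ⟨i, hi, hz⟩ := h
        have hz0 : z i = 0 := by
          revert hz
          generalize z i = b
          revert b
          decide
        rw [Finset.prod_eq_zero (f := fun i => f' i (z i)) (Finset.mem_univ i)
          (if_pos ⟨hi, hz0⟩)]
        ring
    have e1 := ih hgs f
    have e2 := ih hgs f'
    have hout : ∀ i, i ∉ S → ∀ b, f' i b = f i b := fun i hi b => if_neg fun h => hi h.1
    have hblocks : (gs.map fun S => ∏ i ∈ S, (f' i 0 + f' i 1) - 2 * ∏ i ∈ S, f' i 1) =
        gs.map fun S => ∏ i ∈ S, (f i 0 + f i 1) - 2 * ∏ i ∈ S, f i 1 := by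
      refine List.map_congr_left fun T hT => ?_
      have hT' : ∀ i ∈ T, ∀ b, f' i b = f i b := fun i hi =>
        hout i (Finset.disjoint_right.1 (hS T hT) hi)
      congr 1
      · exact Finset.prod_congr rfl fun i hi => by rw [hT' i hi, hT' i hi]
      · congr 1
        exact Finset.prod_congr rfl fun i hi => hT' i hi 1
    have hfree : (Finset.univ.filter fun i => ∀ T ∈ gs, i ∉ T) =
        S ∪ Finset.univ.filter fun i => ∀ T ∈ S :: gs, i ∉ T := by
      ext i
      simp only [Finset.mem_filter, Finset.mem_univ, true_and, Finset.mem_union,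
        List.mem_cons, forall_eq_or_imp]
      constructor
      · intro h
        by_cases hi : i ∈ S
        · exact Or.inl hi
        · exact Or.inr ⟨hi, h⟩
      · rintro (hi | hi)
        · exact fun T hT => Finset.disjoint_left.1 (hS T hT) hi
        · exact hi.2
    have hdisj : Disjoint S (Finset.univ.filter fun i => ∀ T ∈ S :: gs, i ∉ T) := by
      rw [Finset.disjoint_left]
      intro i hi h
      simp at h
      exact h.1 hi
    have hf'S : ∏ i ∈ S, (f' i 0 + f' i 1) = ∏ i ∈ S, f i 1 :=
      Finset.prod_congr rfl fun i hi => by simp [f', hi]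
    have hf'free : ∏ i with ∀ T ∈ S :: gs, i ∉ T, (f' i 0 + f' i 1) =
        ∏ i with ∀ T ∈ S :: gs, i ∉ T, (f i 0 + f i 1) :=
      Finset.prod_congr rfl fun i hi => by
        simp only [Finset.mem_filter, List.mem_cons, forall_eq_or_imp] at hi
        rw [hout i hi.2.1, hout i hi.2.1]
    rw [hfree, Finset.prod_union hdisj] at e1 e2
    rw [hblocks, hf'S, hf'free] at e2
    calc _ = ∑ z : Bits m, ((gs.map fun S => if ∀ i ∈ S, z i = 1 then (-1 : ℂ) else 1).prod *
          ∏ i, f i (z i) - 2 * ((gs.map fun S => if ∀ i ∈ S, z i = 1 then (-1 : ℂ) else 1).prod *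
          ∏ i, f' i (z i))) := by
          refine Finset.sum_congr rfl fun z _ => ?_
          rw [List.map_cons, List.prod_cons, mul_right_comm, hsplit]
          ring
      _ = _ := by
          rw [Finset.sum_sub_distrib, ← Finset.mul_sum, e1, e2, List.map_cons, List.prod_cons]
          ring

/-- The product vector with factors `ξ i`. -/
def prodVec (ξ : Fin m → Fin 2 → ℂ) : State m := fun z => ∏ i, ξ i (z i)

theorem prodVec_vecMul_op (ξ : Fin m → Fin 2 → ℂ) (V : SingleLayer m) :
    Matrix.vecMul (prodVec ξ) V.op =
      prodVec fun i => Matrix.vecMul (ξ i) (V i : Matrix (Fin 2) (Fin 2) ℂ) := by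
  funext x
  simp only [Matrix.vecMul, dotProduct, prodVec, SingleLayer.op, Matrix.of_apply,
    ← Finset.prod_mul_distrib, Fin.sum_univ_two]
  exact sum_prod_eq_prod_sum fun i b => ξ i b * (V i : Matrix (Fin 2) (Fin 2) ℂ) b (x i)

theorem CSignLayer.op_eq_diagonal (L : CSignLayer m) :
    L.op = Matrix.diagonal fun x : Bits m =>
      (L.gates.map fun S => if ∀ i ∈ S, x i = 1 then (-1 : ℂ) else 1).prod := by
  rw [CSignLayer.op]
  induction L.gates with
  | nil => simp
  | cons S l ih =>
    simp only [List.map_cons, List.prod_cons, ih, csign]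
    rw [Matrix.diagonal_mul_diagonal]

theorem CSignLayer.op_mul_op (L : CSignLayer m) : L.op * L.op = 1 := by
  rw [L.op_eq_diagonal, Matrix.diagonal_mul_diagonal, ← Matrix.diagonal_one]
  congr 1
  funext x
  induction L.gates with
  | nil => simp
  | cons S l ih =>
    rw [List.map_cons, List.prod_cons, mul_mul_mul_comm, ih]
    split_ifs <;> simp

theorem SingleLayer.op_mul_op (U V : SingleLayer m) : U.op * V.op = SingleLayer.op (U * V) := by
  ext x y
  simp only [SingleLayer.op, Matrix.mul_apply, Matrix.of_apply, ← Finset.prod_mul_distrib,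
    Pi.mul_apply, Submonoid.coe_mul, Fin.sum_univ_two]
  exact sum_prod_eq_prod_sum fun i b => (U i : Matrix (Fin 2) (Fin 2) ℂ) (x i) b *
    (V i : Matrix (Fin 2) (Fin 2) ℂ) b (y i)

theorem SingleLayer.op_one : SingleLayer.op (1 : SingleLayer m) = 1 := by
  ext x y
  simp only [SingleLayer.op, Matrix.of_apply, Pi.one_apply, OneMemClass.coe_one,
    Matrix.one_apply]
  by_cases h : x = y
  · simp [h]
  · rw [if_neg h]
    obtain ⟨i, hi⟩ := Function.ne_iff.1 h
    exact Finset.prod_eq_zero (Finset.mem_univ i) (if_neg hi)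

/-- The frame of a layer of C-SIGN gates preceded by `W` and followed by `V`. -/
def SingleLayer.frame (V W : SingleLayer m) : Frame (Fin m) where
  A i := (V i * W i : Matrix.unitaryGroup (Fin 2) ℂ)
  c i b := (W i : Matrix (Fin 2) (Fin 2) ℂ) 1 b
  isUnit_det i := Matrix.UnitaryGroup.det_isUnit _
  norm i := by
    have := congrFun (congrFun (Matrix.mem_unitaryGroup_iff.1 (W i).2) 1) 1
    simpa [Matrix.mul_apply, Fin.sum_univ_two, Matrix.star_apply] using this

theorem SingleLayer.frame_lin (V W : SingleLayer m) (i : Fin m) (b : Fin 2) (v : Fin 2 → ℂ) :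
    (V.frame W).lin i b v =
      Matrix.vecMul v (V i : Matrix (Fin 2) (Fin 2) ℂ) 0 * (W i : Matrix (Fin 2) (Fin 2) ℂ) 0 b +
      Matrix.vecMul v (V i : Matrix (Fin 2) (Fin 2) ℂ) 1 *
        (W i : Matrix (Fin 2) (Fin 2) ℂ) 1 b := by
  simp only [Frame.lin, frame, Submonoid.coe_mul]
  rw [← Matrix.vecMul_vecMul, Matrix.vecMul]
  simp only [dotProduct, Fin.sum_univ_two]

/-- Orthonormality of the rows of `W i` isolates the component along its row `1`, the one on which
the C-SIGN gate acts. -/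
theorem SingleLayer.frame_proj (V W : SingleLayer m) (i : Fin m) (v : Fin 2 → ℂ) :
    (V.frame W).proj i v = Matrix.vecMul v (V i : Matrix (Fin 2) (Fin 2) ℂ) 1 := by
  have h := Matrix.mem_unitaryGroup_iff.1 (W i).2
  have h01 := congrFun (congrFun h 0) 1
  have h11 := congrFun (congrFun h 1) 1
  simp only [Matrix.mul_apply, Fin.sum_univ_two, Matrix.star_apply, Matrix.one_apply] at h01 h11
  rw [if_neg (by decide)] at h01
  rw [if_pos trivial] at h11
  rw [Frame.proj, frame_lin, frame_lin]
  simp only [frame]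
  linear_combination Matrix.vecMul v (V i : Matrix (Fin 2) (Fin 2) ℂ) 0 * h01 +
    Matrix.vecMul v (V i : Matrix (Fin 2) (Fin 2) ℂ) 1 * h11

theorem prodVec_dotProduct_layer (V W : SingleLayer m) (L : CSignLayer m) (x : Bits m)
    (ξ : Fin m → Fin 2 → ℂ) :
    prodVec ξ ⬝ᵥ (V.op * L.op * W.op).mulVec (ket x) =
      (L.gates.map fun S => (V.frame W).block 1 S x ξ).prod *
        ∏ i with ∀ S ∈ L.gates, i ∉ S, (V.frame W).lin i (x i) (ξ i) := by
  have h := sum_csign_mul_prod L.gates L.disjoint fun i b =>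
    Matrix.vecMul (ξ i) (V i : Matrix (Fin 2) (Fin 2) ℂ) b *
      (W i : Matrix (Fin 2) (Fin 2) ℂ) b (x i)
  simp only [← SingleLayer.frame_lin] at h
  have hblock : ∀ S : Finset (Fin m), ∏ i ∈ S, (V.frame W).lin i (x i) (ξ i) -
      2 * ∏ i ∈ S, Matrix.vecMul (ξ i) (V i : Matrix (Fin 2) (Fin 2) ℂ) 1 *
        (W i : Matrix (Fin 2) (Fin 2) ℂ) 1 (x i) = (V.frame W).block 1 S x ξ := fun S => by
    rw [Frame.block, mul_one]
    congr 2
    refine Finset.prod_congr rfl fun i _ => ?_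
    rw [SingleLayer.frame_proj, mul_comm]
    rfl
  simp only [hblock] at h
  rw [← h, Matrix.dotProduct_mulVec, ket, dotProduct_single_one, ← Matrix.vecMul_vecMul,
    ← Matrix.vecMul_vecMul, prodVec_vecMul_op, L.op_eq_diagonal, Matrix.vecMul, dotProduct]
  refine Finset.sum_congr rfl fun z _ => ?_
  rw [Matrix.vecMul_diagonal, prodVec, SingleLayer.op, Matrix.of_apply, Finset.prod_mul_distrib]
  ring

/-- A set containing `o` splits off from a layer of C-SIGN gates. -/
theorem exists_gate_mem (D : Frame (Fin m)) (o : Fin m) (gs : List (Finset (Fin m)))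
    (hgs : gs.Pairwise Disjoint) :
    ∃ (S T : Finset (Fin m)) (ε : ℂ) (l : List (Finset (Fin m))), o ∈ S ∧ (ε = 0 ∨ ε = 1) ∧
      Disjoint S T ∧ (∀ S' ∈ l, Disjoint S S') ∧
      ∀ x ξ, (gs.map fun S => D.block 1 S x ξ).prod *
          ∏ i with ∀ S ∈ gs, i ∉ S, D.lin i (x i) (ξ i) =
        D.block ε S x ξ * ((l.map fun S => D.block 1 S x ξ).prod *
          ∏ i ∈ T, D.lin i (x i) (ξ i)) := by
  by_cases h : ∃ S ∈ gs, o ∈ S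
  · obtain ⟨S, hS, ho⟩ := h
    have hp := List.perm_cons_erase hS
    have hpw := (List.Perm.pairwise_iff (fun h => h.symm) hp).1 hgs
    rw [List.pairwise_cons] at hpw
    refine ⟨S, Finset.univ.filter fun i => ∀ S ∈ gs, i ∉ S, 1, gs.erase S, ho, Or.inr rfl, ?_,
      hpw.1, fun x ξ => ?_⟩
    · rw [Finset.disjoint_left]
      intro i hi h
      exact (Finset.mem_filter.1 h).2 S hS hi
    · rw [(hp.map _).prod_eq, List.map_cons, List.prod_cons]
      ring
  · push Not at h
    have ho : o ∈ Finset.univ.filter fun i => ∀ S ∈ gs, i ∉ S := by simpa using h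
    -- An untouched `o` is treated as a gate on `{o}` with its projection term switched off by `ε =
    -- 0`.
    refine ⟨{o}, (Finset.univ.filter fun i => ∀ S ∈ gs, i ∉ S).erase o, 0, gs, by simp,
      Or.inl rfl, by simp, by simpa using h, fun x ξ => ?_⟩
    rw [← Finset.mul_prod_erase _ _ ho]
    simp only [Frame.block, Finset.prod_singleton]
    ring

theorem exists_side (V W : SingleLayer m) (L : CSignLayer m) (o : Fin m) :
    ∃ Y : Side (Fin m) o, ∀ x ξ,
      prodVec ξ ⬝ᵥ (V.op * L.op * W.op).mulVec (ket x) = Y.F x ξ := by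
  obtain ⟨S, T, ε, l, ho, hε, hT, hl, hF⟩ := exists_gate_mem (V.frame W) o L.gates L.disjoint
  refine ⟨{ toFrame := V.frame W
            S := S
            mem_S := ho
            ε := ε
            ε_eq := hε
            rest := fun x ξ => (l.map fun S => (V.frame W).block 1 S x ξ).prod *
              ∏ i ∈ T, (V.frame W).lin i (x i) (ξ i)
            isNonzeroPoly_rest := fun x =>
              (IsNonzeroPoly.list_prod (fun S => Frame.isNonzeroPoly_block _ (Or.inr rfl) S x) l).mul
                (IsNonzeroPoly.prod (fun i => Frame.isNonzeroPoly_lin _ i (x i)) T)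
            rest_congr := fun x x' ξ ξ' h => ?_ },
    fun x ξ => by rw [prodVec_dotProduct_layer, hF]; rfl⟩
  congr 1
  · congr 1
    refine List.map_congr_left fun S' hS' => ?_
    have h' : ∀ i ∈ S', x i = x' i ∧ ξ i = ξ' i := fun i hi =>
      h i (Finset.disjoint_right.1 (hl S' hS') hi)
    rw [Frame.block, Frame.block]
    congr 1
    · exact Finset.prod_congr rfl fun i hi => by rw [(h' i hi).1, (h' i hi).2]
    · congr 1
      exact Finset.prod_congr rfl fun i hi => by rw [(h' i hi).1, (h' i hi).2]
  · refine Finset.prod_congr rfl fun i hi => ?_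
    obtain ⟨h1, h2⟩ := h i (Finset.disjoint_right.1 hT hi)
    rw [h1, h2]

end Layer

/-! ### Parity in depth two -/

theorem tensor_ket {n a : ℕ} (x : Bits n) (y : Bits a) :
    tensor (ket x) (ket y) = ket (Fin.append x y) := by
  funext z
  have : z = Fin.append x y ↔
      (fun i => z (Fin.castAdd a i)) = x ∧ (fun i => z (Fin.natAdd n i)) = y := by
    constructor
    · rintro rfl
      simp
    · rintro ⟨rfl, rfl⟩
      exact (Fin.append_castAdd_natAdd (f := z)).symm
  simp only [tensor, ket, Pi.single_apply, this, ite_and, mul_ite, mul_one, mul_zero]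
  split_ifs <;> rfl

theorem classicalGate_mulVec_ket {n : ℕ} (f : Bits n → Bits n) (x : Bits n) :
    (classicalGate f).mulVec (ket x) = ket (f x) := by
  funext y
  rw [ket, Matrix.mulVec_single_one, ket, Pi.single_apply]
  rfl

theorem not_cleanlySimulates_parityGate {n : ℕ} (hn : 4 ≤ n) {a : ℕ} (C : Circuit (n + a) 2) :
    ¬ C.CleanlySimulates (parityGate n) := by
  intro hC
  obtain ⟨n, rfl⟩ := Nat.exists_eq_add_of_le' hn
  match C, hC with
  | .step (.step (.single U₀) L₁ U₁) L₂ U₂, hC => ?_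
  set q : Fin (n + 4) → Fin (n + 4 + a) := Fin.castAdd a with hq
  have hinj : Injective q := Fin.castAdd_injective _ _
  obtain ⟨X, hX⟩ := exists_side U₁ U₀ L₁ (q 0)
  -- `L₂` is its own inverse, so moving `U₂` and `L₂` to the right-hand side gives the layer `L₂.op
  -- * SingleLayer.op U₂⁻¹`.
  obtain ⟨Y, hY⟩ := exists_side 1 U₂⁻¹ L₂ (q 0)
  have v2 : 2 % (n + 4) = 2 := Nat.mod_eq_of_lt (by omega)
  have v3 : 3 % (n + 4) = 3 := Nat.mod_eq_of_lt (by omega)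
  have n10 : (1 : Fin (n + 4)) ≠ 0 := by simp
  have n20 : (2 : Fin (n + 4)) ≠ 0 := by simp [Fin.ext_iff, v2]
  have n30 : (3 : Fin (n + 4)) ≠ 0 := by simp [Fin.ext_iff, v3]
  have n12 : (1 : Fin (n + 4)) ≠ 2 := by simp [Fin.ext_iff, v2]
  have n13 : (1 : Fin (n + 4)) ≠ 3 := by simp [Fin.ext_iff, v3]
  have n23 : (2 : Fin (n + 4)) ≠ 3 := by simp [Fin.ext_iff, v2, v3]
  refine Side.not_parityRelated (X := X) (Y := Y) (j := q 1) (k := q 2) (l := q 3)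
    (hinj.ne n10) (hinj.ne n20) (hinj.ne n30) (hinj.ne n12) (hinj.ne n13) (hinj.ne n23) ?_
  intro x ξ hx
  set x' : Bits (n + 4) := fun i => x (q i) with hx'
  have hanc : ∀ i, x (Fin.natAdd (n + 4) i) = 0 := fun i => by
    have : ∀ s, Fin.natAdd (n + 4) i ≠ q s := fun s h => by
      have := congrArg Fin.val h
      simp [hq] at this
      omega
    exact hx _ (this _) (this _) (this _) (this _)
  have hin : ∀ i, i ≠ 0 → i ≠ 1 → i ≠ 2 → i ≠ 3 → x' i = 0 := fun i h0 h1 h2 h3 =>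
    hx _ (hinj.ne h0) (hinj.ne h1) (hinj.ne h2) (hinj.ne h3)
  have hsum : ∑ i, x' i = x (q 0) + x (q 1) + x (q 2) + x (q 3) := by
    rw [← Finset.sum_subset (Finset.subset_univ {0, 1, 2, 3}) fun i _ hi => by
      simp only [Finset.mem_insert, Finset.mem_singleton, not_or] at hi
      exact hin i hi.1 hi.2.1 hi.2.2.1 hi.2.2.2]
    rw [Finset.sum_insert (by simp [n10.symm, n20.symm, n30.symm]),
      Finset.sum_insert (by simp [n12, n13]), Finset.sum_insert (by simp [n23]),
      Finset.sum_singleton]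
    simp only [hx', add_assoc]
  have hxa : Fin.append x' (0 : Bits a) = x := by
    funext i
    refine Fin.addCases (fun i => ?_) (fun i => ?_) i
    · simp [hx', hq]
    · simp [hanc]
  have hya : Fin.append (fun i : Fin (n + 4) => if (i : ℕ) = 0 then ∑ j, x' j else x' i)
      (0 : Bits a) = update x (q 0) (x (q 0) + x (q 1) + x (q 2) + x (q 3)) := by
    funext i
    refine Fin.addCases (fun i => ?_) (fun i => ?_) i
    · rw [Fin.append_left]
      by_cases hi : i = 0
      · subst hi
        rw [← hq, update_self, ← hsum]
        simp
      · have hi' : (i : ℕ) ≠ 0 := fun h => hi (Fin.ext h)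
        rw [← hq, update_of_ne (hinj.ne hi), if_neg hi']
    · rw [Fin.append_right, update_of_ne, hanc]
      · rfl
      · intro h
        have := congrArg Fin.val h
        simp [hq] at this
  have h := hC x'
  rw [parityGate, classicalGate_mulVec_ket, tensor_ket, tensor_ket, hxa, hya] at h
  simp only [Circuit.op] at h
  have h2 := congrArg (Matrix.mulVec (L₂.op * SingleLayer.op U₂⁻¹)) h
  have hU : SingleLayer.op U₂⁻¹ * U₂.op = 1 := by
    rw [SingleLayer.op_mul_op, inv_mul_cancel, SingleLayer.op_one]
  have hprod : L₂.op * SingleLayer.op U₂⁻¹ * (U₂.op * L₂.op * (U₁.op * L₁.op * U₀.op)) =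
      U₁.op * L₁.op * U₀.op := by
    calc _ = L₂.op * (SingleLayer.op U₂⁻¹ * U₂.op) * L₂.op * (U₁.op * L₁.op * U₀.op) := by
          simp only [mul_assoc]
      _ = _ := by rw [hU, mul_one, L₂.op_mul_op, one_mul]
  rw [Matrix.mulVec_mulVec, hprod] at h2
  rw [← hX, ← hY, h2, SingleLayer.op_one, one_mul]

/-! ### Hadamard conjugation and fanout -/

/-- The sign `(-1) ^ (b * c)`. -/
def bitSign (b c : Fin 2) : ℤ := if b = 1 ∧ c = 1 then -1 else 1

theorem bitSign_add_left (b b' c : Fin 2) :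
    bitSign (b + b') c = bitSign b c * bitSign b' c := by
  revert b b' c; decide

theorem bitSign_add_right (b c c' : Fin 2) :
    bitSign b (c + c') = bitSign b c * bitSign b c' := by
  revert b c c'; decide

theorem bitSign_sum_left {κ : Type*} (s : Finset κ) (f : κ → Fin 2) (c : Fin 2) :
    bitSign (∑ i ∈ s, f i) c = ∏ i ∈ s, bitSign (f i) c := by
  classical
  induction s using Finset.induction_on with
  | empty => simp [bitSign]
  | insert a s ha ih => rw [Finset.sum_insert ha, Finset.prod_insert ha, bitSign_add_left, ih]

theorem sqrt_two_inv_mul_self : ((√2 : ℝ) : ℂ)⁻¹ * ((√2 : ℝ) : ℂ)⁻¹ = 1 / 2 := by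
  rw [← mul_inv, ← Complex.ofReal_mul, Real.mul_self_sqrt (by norm_num)]
  norm_num

/-- The Hadamard gate. -/
noncomputable def hadamardGate : Matrix.unitaryGroup (Fin 2) ℂ :=
  ⟨Matrix.of fun b c => ((√2 : ℝ) : ℂ)⁻¹ * bitSign b c, by
    rw [Matrix.mem_unitaryGroup_iff]
    ext b c
    simp only [Matrix.mul_apply, Matrix.star_apply, Matrix.of_apply, Fin.sum_univ_two,
      star_mul', star_inv₀, RCLike.star_def, Complex.conj_ofReal, map_intCast]
    have h : bitSign b 0 * bitSign c 0 + bitSign b 1 * bitSign c 1 = if b = c then 2 else 0 := by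
      revert b c; decide
    have h' := congrArg (fun t : ℤ => (t : ℂ)) h
    push_cast at h'
    rw [Matrix.one_apply]
    split_ifs at h' ⊢
    · linear_combination (((√2 : ℝ) : ℂ)⁻¹ * ((√2 : ℝ) : ℂ)⁻¹) * h' + 2 * sqrt_two_inv_mul_self
    · linear_combination (((√2 : ℝ) : ℂ)⁻¹ * ((√2 : ℝ) : ℂ)⁻¹) * h'⟩

theorem hadamardGate_apply (b c : Fin 2) :
    (hadamardGate : Matrix (Fin 2) (Fin 2) ℂ) b c = ((√2 : ℝ) : ℂ)⁻¹ * bitSign b c := rfl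

theorem hadamardGate_mul_self : hadamardGate * hadamardGate = 1 := by
  have h : star hadamardGate = hadamardGate := by
    ext b c
    have : bitSign c b = bitSign b c := by revert b c; decide
    rw [Unitary.coe_star, Matrix.star_apply, hadamardGate_apply, hadamardGate_apply,
      this]
    simp
  calc _ = star hadamardGate * hadamardGate := by rw [h]
    _ = 1 := Unitary.star_mul_self _

section Clean

variable {n a : ℕ}

/-- The isometry that adds ancilla qubits in the state `|0⟩`. -/
def addAncillas (n a : ℕ) : Matrix (Bits (n + a)) (Bits n) ℂ :=
  Matrix.of fun z x => tensor (ket x) (ket 0) z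

theorem addAncillas_mulVec (ψ : State n) : (addAncillas n a).mulVec ψ = tensor ψ (ket 0) := by
  funext z
  simp only [addAncillas, Matrix.mulVec, dotProduct, Matrix.of_apply, tensor]
  rw [Finset.sum_eq_single fun i => z (Fin.castAdd a i)]
  · simp [ket, mul_comm]
  · intro x _ hx
    simp [ket, Pi.single_apply, hx.symm]
  · simp

theorem cleanlySimulates_iff {d : ℕ} (C : Circuit (n + a) d) (G : Op n) :
    C.CleanlySimulates G ↔ C.op * addAncillas n a = addAncillas n a * G := by
  simp only [Circuit.CleanlySimulates, ← addAncillas_mulVec, Matrix.mulVec_mulVec]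
  exact ⟨fun h => Matrix.ext_of_mulVec_single h, fun h x => by rw [h]⟩

theorem append_one_op_mul_addAncillas (U : SingleLayer n) :
    SingleLayer.op (Fin.append U (1 : SingleLayer a)) * addAncillas n a =
      addAncillas n a * U.op := by
  refine Matrix.ext_of_mulVec_single fun x => ?_
  rw [← Matrix.mulVec_mulVec, ← Matrix.mulVec_mulVec, addAncillas_mulVec, addAncillas_mulVec,
    ← ket, tensor_ket, ket, Matrix.mulVec_single_one, ket, Matrix.mulVec_single_one]
  funext z
  simp only [Matrix.col_apply, tensor, SingleLayer.op, Matrix.of_apply, Fin.prod_univ_add,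
    Fin.append_left, Fin.append_right]
  congr 1
  have h := congrFun (congrFun (SingleLayer.op_one (m := a)) fun j => z (Fin.natAdd n j)) 0
  rw [SingleLayer.op, Matrix.of_apply, Matrix.one_apply] at h
  rw [ket, Pi.single_apply]
  exact h

end Clean

/-- Fanout and parity are transposed linear maps over the field with two elements, and the entries
of the Hadamard layer are, up to a common factor, the signs of the standard bilinear form. Parity
being an involution, its matrix moves to the row index. -/
theorem hadamard_mul_fanoutGate (n : ℕ) :
    SingleLayer.op (fun _ : Fin n => hadamardGate) * fanoutGate n =
      parityGate n * SingleLayer.op fun _ => hadamardGate := by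
  cases n with
  | zero =>
    have h : fanoutGate 0 = parityGate 0 := by
      ext x y
      simp [fanoutGate, parityGate, classicalGate, funext_iff]
    have h1 : parityGate 0 = 1 := by
      ext x y
      obtain rfl := Subsingleton.elim x y
      simp [parityGate, classicalGate, funext_iff]
    rw [h, h1, mul_one, one_mul]
  | succ n =>
    ext y x
    set P : Bits (n + 1) → Bits (n + 1) := fun x i => if (i : ℕ) = 0 then ∑ j, x j else x i with hP
    have hPP : ∀ x, P (P x) = x := fun x => by
      have h0 : ∀ p q : Fin 2, p + q + q = p := by decide
      funext i
      refine Fin.cases ?_ (fun i => ?_) i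
      · simp [hP, Fin.sum_univ_succ, h0]
      · simp [hP]
    have hl : (SingleLayer.op (fun _ : Fin (n + 1) => hadamardGate) * fanoutGate (n + 1)) y x =
        ∏ i, (hadamardGate : Matrix (Fin 2) (Fin 2) ℂ) (y i)
          (if (i : ℕ) = 0 then x i else x ⟨0, i.pos⟩ + x i) := by
      simp [Matrix.mul_apply, fanoutGate, classicalGate, SingleLayer.op]
    have hr : (parityGate (n + 1) * SingleLayer.op fun _ : Fin (n + 1) => hadamardGate) y x =
        ∏ i, (hadamardGate : Matrix (Fin 2) (Fin 2) ℂ) (P y i) (x i) := by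
      have : ∀ z, y = P z ↔ z = P y := fun z =>
        ⟨fun h => by rw [h, hPP], fun h => by rw [h, hPP]⟩
      rw [show parityGate (n + 1) = classicalGate P from rfl]
      simp [Matrix.mul_apply, classicalGate, SingleLayer.op, this]
    rw [hl, hr]
    simp only [hadamardGate_apply, Finset.prod_mul_distrib]
    congr 1
    simp only [← Int.cast_prod]
    congr 1
    simp only [Fin.prod_univ_succ, hP]
    simp only [Fin.val_zero, if_true, Fin.val_succ, Nat.succ_ne_zero, if_false]
    rw [bitSign_sum_left, Fin.prod_univ_succ]
    simp only [bitSign_add_right, Finset.prod_mul_distrib]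
    rw [mul_assoc]
    rfl

theorem not_cleanlySimulates_fanoutGate {n : ℕ} (hn : 4 ≤ n) {a : ℕ} (C : Circuit (n + a) 2) :
    ¬ C.CleanlySimulates (fanoutGate n) := by
  intro hC
  rw [cleanlySimulates_iff] at hC
  match C, hC with
  | .step (.step (.single U₀) L₁ U₁) L₂ U₂, hC => ?_
  let H : SingleLayer n := fun _ => hadamardGate
  -- The ancilla qubits get the identity, so they stay in state `|0⟩`.
  let H' : SingleLayer (n + a) := Fin.append H 1
  refine not_cleanlySimulates_parityGate hn
    (.step (.step (.single (U₀ * H')) L₁ U₁) L₂ (H' * U₂)) ((cleanlySimulates_iff _ _).2 ?_)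
  have hH : H.op * H.op = 1 := by
    rw [SingleLayer.op_mul_op, ← SingleLayer.op_one]
    congr 1
    exact funext fun _ => hadamardGate_mul_self
  have hA : H'.op * addAncillas n a = addAncillas n a * H.op := append_one_op_mul_addAncillas H
  have hF : H.op * fanoutGate n = parityGate n * H.op := hadamard_mul_fanoutGate n
  simp only [Circuit.op] at hC ⊢
  rw [← SingleLayer.op_mul_op, ← SingleLayer.op_mul_op]
  calc _ = H'.op * (U₂.op * L₂.op * (U₁.op * L₁.op * U₀.op) * (H'.op * addAncillas n a)) := by
        simp only [Matrix.mul_assoc]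
    _ = H'.op * (U₂.op * L₂.op * (U₁.op * L₁.op * U₀.op) * addAncillas n a) * H.op := by
        rw [hA]; simp only [Matrix.mul_assoc]
    _ = H'.op * addAncillas n a * (fanoutGate n * H.op) := by
        rw [hC]; simp only [Matrix.mul_assoc]
    _ = addAncillas n a * (H.op * fanoutGate n) * H.op := by
        rw [hA]; simp only [Matrix.mul_assoc]
    _ = addAncillas n a * parityGate n * (H.op * H.op) := by
        rw [hF]; simp only [Matrix.mul_assoc]
    _ = _ := by rw [hH, Matrix.mul_one]

/-! ### A depth-two circuit for parity of three bits -/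

/-- Two controlled-NOT gates with common target `0` are two binary C-SIGN gates conjugated by
Hadamard gates on the target; the Hadamard gates between them cancel. -/
theorem exists_cleanlySimulates_parityGate_three :
    ∃ C : Circuit (3 + 0) 2, C.CleanlySimulates (parityGate 3) := by
  let H : SingleLayer 3 := ![hadamardGate, 1, 1]
  let L₁ : CSignLayer 3 := ⟨[{0, 1}], List.pairwise_singleton _ _⟩
  let L₂ : CSignLayer 3 := ⟨[{0, 2}], List.pairwise_singleton _ _⟩
  refine ⟨.step (.step (.single H) L₁ 1) L₂ H, fun x => ?_⟩
  let h : Bits 3 → Bits 3 → ℤ := fun y z =>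
    if y 1 = z 1 ∧ y 2 = z 2 then bitSign (y 0) (z 0) else 0
  have hH : ∀ y z, H.op y z = ((√2 : ℝ) : ℂ)⁻¹ * h y z := fun y z => by
    simp only [SingleLayer.op, Matrix.of_apply, Fin.prod_univ_three, H, h]
    simp [hadamardGate_apply, Matrix.one_apply]
    split_ifs <;> simp_all
  have hL₁ : L₁.op = Matrix.diagonal fun z => (bitSign (z 0) (z 1) : ℂ) := by
    simp only [CSignLayer.op, L₁, List.map_cons, List.map_nil, List.prod_singleton, csign]
    congr 1
    funext z
    simp [bitSign]
  have hL₂ : L₂.op = Matrix.diagonal fun z => (bitSign (z 0) (z 2) : ℂ) := by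
    simp only [CSignLayer.op, L₂, List.map_cons, List.map_nil, List.prod_singleton, csign]
    congr 1
    funext z
    simp [bitSign]
  -- With the factors `1 / √2` pulled out, the matrix identity is over the integers and can be
  -- decided.
  have key : ∀ y x : Bits 3,
      ∑ z, h y z * bitSign (z 0) (z 2) * (bitSign (z 0) (z 1) * h z x) =
        if y = fun i : Fin 3 => if (i : ℕ) = 0 then ∑ j, x j else x i then 2 else 0 := by
    decide
  have hmul : H.op * L₂.op * (L₁.op * H.op) = parityGate 3 := by
    ext y x
    rw [hL₁, hL₂, Matrix.mul_apply]
    simp only [Matrix.mul_diagonal, Matrix.diagonal_mul, hH]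
    have hk := congrArg (fun t : ℤ => (t : ℂ)) (key y x)
    push_cast at hk
    rw [parityGate, classicalGate, Matrix.of_apply]
    calc _ = (((√2 : ℝ) : ℂ)⁻¹ * ((√2 : ℝ) : ℂ)⁻¹) * ∑ z : Bits 3,
          (h y z : ℂ) * bitSign (z 0) (z 2) * (bitSign (z 0) (z 1) * h z x) := by
          rw [Finset.mul_sum]
          exact Finset.sum_congr rfl fun z _ => by ring
      _ = _ := by
          rw [hk, sqrt_two_inv_mul_self]
          split_ifs <;> norm_num
  have hop : (Circuit.step (.step (.single H) L₁ 1) L₂ H : Circuit 3 2).op = parityGate 3 := by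
    simp only [Circuit.op]
    rw [SingleLayer.op_one, one_mul, hmul]
  have htensor : ∀ ψ : State 3, tensor ψ (ket (0 : Bits 0)) = ψ := fun ψ => by
    funext z
    have : (ket (0 : Bits 0)) (fun j => z (Fin.natAdd 3 j)) = 1 := by
      rw [ket, Subsingleton.elim (fun j => z (Fin.natAdd 3 j)) (0 : Bits 0), Pi.single_eq_same]
    rw [tensor, this, mul_one]
    rfl
  rw [htensor, htensor]
  exact congrArg (fun M : Op 3 => M.mulVec (ket x)) hop

end QAC

theorem theorem1 :
    (∀ n : ℕ, 4 ≤ n → ∀ a : ℕ,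
      (¬ ∃ C : QAC.Circuit (n + a) 2, C.CleanlySimulates (QAC.parityGate n)) ∧
      (¬ ∃ C : QAC.Circuit (n + a) 2, C.CleanlySimulates (QAC.fanoutGate n))) ∧
    (∃ C : QAC.Circuit (3 + 0) 2, C.CleanlySimulates (QAC.parityGate 3)) :=
  ⟨fun _ hn _ => ⟨fun ⟨C, hC⟩ => QAC.not_cleanlySimulates_parityGate hn C hC,
    fun ⟨C, hC⟩ => QAC.not_cleanlySimulates_fanoutGate hn C hC⟩,
    QAC.exists_cleanlySimulates_parityGate_three⟩
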